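/- Throughout, $\lambda$ and $\kappa$ are infinite cardinals (regular or singular), $\omega$ carries the discrete topology and its powers the product topology. A topological space is \emph{finally $\lambda$-compact} if every open cover has a subcover of cardinality $<\lambda$, and \emph{$[\lambda,\lambda]$-compact} if every open cover by at most $\lambda$ sets has a subcover by fewer than $\lambda$ sets. Let $\mathcal L_{\omega_1,\omega}$ be first-order logic extended by conjunctions and disjunctions of countably many formulas. It is \emph{$(\lambda,\lambda)$-compact} if every set of at most $\lambda$ sentences, all of whose subsets of cardinality $<\lambda$ are satisfiable, is satisfiable. It is \emph{$\kappa$-$(\lambda,\lambda)$-compact} if for all sets of sentences $\Sigma,\Gamma$ with $|\Sigma|\le\kappa$ and $|\Gamma|\le\lambda$ such that $\Sigma\cup\Gamma'$ is satisfiable for every $\Gamma'\subseteq\Gamma$ of cardinality $<\lambda$, the set $\Sigma\cup\Gamma$ is satisfiable. Let $[\lambda]^{<\lambda}$ be the set of all subsets of $\lambda$ of cardinality $<\lambda$. An ultrafilter $D$ over $[\lambda]^{<\lambda}$ \emph{covers $\lambda$} if $\{s\in[\lambda]^{<\lambda}\mid \alpha\in s\}\in D$ for every $\alpha\in\lambda$.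 For $f:[\lambda]^{<\lambda}\to\omega$, let $f(D)$ be the ultrafilter over $\omega$ given by $Y\in f(D)$ iff $f^{-1}(Y)\in D$. An ultrafilter over $\omega$ is \emph{uniform} if all its members are infinite. The principle $(\lambda,\lambda)\not\Rightarrow^{\kappa}\omega$ says that for every family $(f_\gamma)_{\gamma\in\kappa}$ of functions $f_\gamma:[\lambda]^{<\lambda}\to\omega$ there is an ultrafilter $D$ over $[\lambda]^{<\lambda}$ covering $\lambda$ such that $f_\gamma(D)$ is uniform for no $\gamma\in\kappa$. \textbf{Theorem.} For every infinite cardinal $\lambda$, the space $\omega^\lambda$ is finally $\lambda$-compact if and only if $\mathcal L_{\omega_1,\omega}$ is $(\lambda,\lambda)$-compact. More generally, if $\kappa\ge\lambda$, then the following conditions are equivalent: \begin{enumerate} \item $\omega^\kappa$ is $[\lambda,\lambda]$-compact. \item $\mathcal L_{\omega_1,\omega}$ is $\kappa$-$(\lambda,\lambda)$-compact. \item $(\lambda,\lambda)\not\Rightarrow^{\kappa}\omega$. \end{enumerate} -/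

import Mathlib

universe u v w

open Cardinal

/-! Compactness of topological spaces -/

/-- `X` is `[μ, ν]`-compact: every open cover of `X` by at most `ν` sets has a subcover by
fewer than `μ` sets. -/
def IsIntervalCompact (μ ν : Cardinal.{u}) (X : Type u) [TopologicalSpace X] : Prop :=
  ∀ C : Set (Set X), (∀ U ∈ C, IsOpen U) → ⋃₀ C = Set.univ → #C ≤ ν →
    ∃ C' ⊆ C, ⋃₀ C' = Set.univ ∧ #C' < μ

/-- `X` is finally `μ`-compact: every open cover of `X` has a subcover of cardinality
strictly less than `μ`. -/
def IsFinallyCompact (μ : Cardinal.{u}) (X : Type u) [TopologicalSpace X] : Prop :=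
  ∀ C : Set (Set X), (∀ U ∈ C, IsOpen U) → ⋃₀ C = Set.univ →
    ∃ C' ⊆ C, ⋃₀ C' = Set.univ ∧ #C' < μ

/-! The infinitary logic `L_{ω₁,ω}` -/

/-- Formulas of `L_{ω₁,ω}` in the vocabulary `L` whose free variables are among
`x_0, …, x_{n-1}` (every subformula of a sentence has only finitely many free variables).
Conjunctions and disjunctions of finite nonempty families are obtained by repetition, or with
`imp` and `falsum`. -/
inductive LomegaFormula (L : FirstOrder.Language.{u, v}) : ℕ → Type (max u v)
  | falsum {n : ℕ} : LomegaFormula L n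
  | equal {n : ℕ} (t₁ t₂ : L.Term (Fin n)) : LomegaFormula L n
  | rel {n k : ℕ} (R : L.Relations k) (ts : Fin k → L.Term (Fin n)) : LomegaFormula L n
  | imp {n : ℕ} (φ ψ : LomegaFormula L n) : LomegaFormula L n
  | all {n : ℕ} (φ : LomegaFormula L (n + 1)) : LomegaFormula L n
  | conj {n : ℕ} (φ : ℕ → LomegaFormula L n) : LomegaFormula L n
  | disj {n : ℕ} (φ : ℕ → LomegaFormula L n) : LomegaFormula L n

/-- The satisfaction relation of `L_{ω₁,ω}`. -/
def LomegaFormula.Realize {L : FirstOrder.Language.{u, v}} {M : Type w} [L.Structure M] :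
    {n : ℕ} → LomegaFormula L n → (Fin n → M) → Prop
  | _, .falsum, _ => False
  | _, .equal t₁ t₂, x => t₁.realize x = t₂.realize x
  | _, .rel R ts, x => FirstOrder.Language.Structure.RelMap R fun i => (ts i).realize x
  | _, .imp φ ψ, x => φ.Realize x → ψ.Realize x
  | _, .all φ, x => ∀ a : M, φ.Realize (Fin.snoc x a)
  | _, .conj φ, x => ∀ i, (φ i).Realize x
  | _, .disj φ, x => ∃ i, (φ i).Realize x

/-- Sentences of `L_{ω₁,ω}` in the vocabulary `L`. -/
abbrev LomegaSentence (L : FirstOrder.Language.{u, v}) : Type (max u v) :=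
  LomegaFormula L 0

/-- A set of sentences of `L_{ω₁,ω}` is satisfiable if it has a (nonempty) model. -/
def LomegaSatisfiable {L : FirstOrder.Language.{u, u}} (T : Set (LomegaSentence L)) : Prop :=
  ∃ (M : Type u) (_ : L.Structure M), Nonempty M ∧
    ∀ φ ∈ T, LomegaFormula.Realize φ (default : Fin 0 → M)

/-- `Γ` is `μ`-satisfiable relative to `S`. -/
def LomegaSatisfiableRel {L : FirstOrder.Language.{u, u}} (μ : Cardinal.{u})
    (Γ S : Set (LomegaSentence L)) : Prop :=
  ∀ Γ' ⊆ Γ, #Γ' < μ → LomegaSatisfiable (S ∪ Γ')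

/-- `L_{ω₁,ω}` is `κ`-`(ν, μ)`-compact. -/
def LomegaRelCompact (κ ν μ : Cardinal.{u}) : Prop :=
  ∀ (L : FirstOrder.Language.{u, u}) (S Γ : Set (LomegaSentence L)),
    #S ≤ κ → #Γ ≤ ν → LomegaSatisfiableRel μ Γ S → LomegaSatisfiable (S ∪ Γ)

/-- `L_{ω₁,ω}` is `(ν, μ)`-compact: a set of at most `ν` sentences is satisfiable as soon as
all its subsets of cardinality less than `μ` are. -/
def LomegaCompact (ν μ : Cardinal.{u}) : Prop :=
  ∀ (L : FirstOrder.Language.{u, u}) (Γ : Set (LomegaSentence L)),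
    #Γ ≤ ν → (∀ Γ' ⊆ Γ, #Γ' < μ → LomegaSatisfiable Γ') → LomegaSatisfiable Γ

/-! Ultrafilters -/

/-- `[ν]^{<ν}`, the set of all subsets of `ν` of cardinality less than `ν`; here `ν.out` is a
set of cardinality `ν`. -/
abbrev SmallSubsets (ν : Cardinal.{u}) : Type u :=
  {s : Set ν.out // #s < ν}

/-- An ultrafilter over `[ν]^{<ν}` covers `ν`. -/
def UltrafilterCovers {ν : Cardinal.{u}} (D : Ultrafilter (SmallSubsets ν)) : Prop :=
  ∀ a : ν.out, {s : SmallSubsets ν | a ∈ s.1} ∈ D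

/-- An ultrafilter over `J` is uniform if all of its members have the cardinality of `J`. -/
def UltrafilterUniform {J : Type v} (D : Ultrafilter J) : Prop :=
  ∀ Y ∈ D, #Y = #J

/-- The principle `(ν, ν) ⇏ (μ_γ)_{γ ∈ G}`, where `M γ` is a set of cardinality `μ_γ`. -/
def NotImpliesFamily (ν : Cardinal.{u}) {G : Type w} (M : G → Type v) : Prop :=
  ∀ f : (γ : G) → SmallSubsets ν → M γ,
    ∃ D : Ultrafilter (SmallSubsets ν), UltrafilterCovers D ∧
      ∀ γ : G, ¬ UltrafilterUniform (D.map (f γ))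

/-- The principle `(ν, ν) ⇏^κ ω`. -/
def NotImpliesOmega (ν κ : Cardinal.{u}) : Prop :=
  NotImpliesFamily ν fun _ : κ.out => ℕ

open Filter Topology

/-! ### Cardinal arithmetic -/

/-! Everything passes through the ultrafilter principle. An ultrafilter over `ℕ` that is not uniform
is principal, so the principle says that any `κ` functions to `ℕ` become constant modulo some
covering ultrafilter `D`.

Topology: `κ` such functions form one map `x` into `ω^κ`, and they are all constant modulo `D`
exactly when `x` converges along `D`.

Logic to ultrafilters: a propositional theory with variables naming sets of small subsets describes
the required `D`.

Ultrafilters to logic: take an ultraproduct of models of the small subtheories. Łoś's theorem fails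
for countable connectives unless `D` can choose an index for each instance. Cutting the ultraproduct
down to a Skolem hull of size at most `κ` leaves only `κ` instances to decide
(`SmallUltraproduct.realize_iff`).

The first equivalence is the case `κ = λ`: `ω^λ` has a base of size `λ`, and the side theory can be
absorbed. -/

/-- Finiteness of the pieces replaces regularity of `c`, so singular cardinals are covered. -/
theorem mk_iUnion_finset_lt {α ι : Type u} {c : Cardinal.{u}} (hc : ℵ₀ ≤ c) (hι : #ι < c)
    (r : ι → Finset α) : #(⋃ i, (r i : Set α)) < c := by
  rcases finite_or_infinite ι with h | h
  · exact (lt_aleph0_iff_set_finite.2 (Set.finite_iUnion fun i => (r i).finite_toSet)).trans_le hc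
  · refine lt_of_le_of_lt ?_ hι
    have hsup : ⨆ i, #(r i : Set α) ≤ ℵ₀ :=
      ciSup_le' fun i => (lt_aleph0_iff_set_finite.2 (r i).finite_toSet).le
    calc #(⋃ i, (r i : Set α)) ≤ #ι * ⨆ i, #(r i : Set α) := mk_iUnion_le _
      _ ≤ #ι * ℵ₀ := mul_le_mul_right hsup _
      _ = #ι := mul_aleph0_eq (aleph0_le_mk ι)

/-! ### Ultrafilters covering a cardinal -/

theorem not_ultrafilterUniform_nat_iff (D : Ultrafilter ℕ) :
    ¬ UltrafilterUniform D ↔ ∃ n, {n} ∈ D := by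
  constructor
  · intro h
    simp only [UltrafilterUniform, not_forall] at h
    obtain ⟨Y, hY, hne⟩ := h
    have hfin : Y.Finite := by
      by_contra hinf
      have : Infinite Y := Set.infinite_coe_iff.2 hinf
      exact hne (by simp)
    obtain ⟨n, -, rfl⟩ := Ultrafilter.eq_pure_of_finite_mem hfin hY
    exact ⟨n, Ultrafilter.mem_pure.2 rfl⟩
  · rintro ⟨n, hn⟩ h
    have := h _ hn
    simp only [mk_singleton, mk_nat] at this
    exact one_lt_aleph0.ne this

theorem notImpliesOmega_iff {lam kap : Cardinal.{u}} :
    NotImpliesOmega lam kap ↔ ∀ f : kap.out → SmallSubsets lam → ℕ,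
      ∃ D : Ultrafilter (SmallSubsets lam), UltrafilterCovers D ∧
        ∀ g, ∃ n, {s | f g s = n} ∈ D := by
  simp only [NotImpliesOmega, NotImpliesFamily, not_ultrafilterUniform_nat_iff]
  rfl

theorem NotImpliesOmega.exists_ultrafilter {lam kap : Cardinal.{u}} (h : NotImpliesOmega lam kap)
    {G : Type u} (hG : #G ≤ kap) (f : G → SmallSubsets lam → ℕ) :
    ∃ D : Ultrafilter (SmallSubsets lam), UltrafilterCovers D ∧
      ∀ g, ∃ n, {s | f g s = n} ∈ D := by
  rw [← mk_out kap] at hG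
  obtain ⟨e⟩ := hG
  obtain ⟨D, hD, hf⟩ := notImpliesOmega_iff.1 h (Function.extend e f fun _ _ => 0)
  refine ⟨D, hD, fun g => ?_⟩
  simpa only [e.injective.extend_apply] using hf (e g)

/-- The filter of the sets of small subsets generated by the sets `{s | a ∈ s}`. -/
def coveringFilter (lam : Cardinal.{u}) : Filter (SmallSubsets lam) :=
  ⨅ a : Finset lam.out, 𝓟 {s | (a : Set lam.out) ⊆ s.1}

theorem hasBasis_coveringFilter (lam : Cardinal.{u}) :
    (coveringFilter lam).HasBasis (fun _ : Finset lam.out => True)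
      fun a => {s | (a : Set lam.out) ⊆ s.1} := by
  classical
  refine hasBasis_iInf_principal fun a b => ⟨a ∪ b, fun s hs => ?_, fun s hs => ?_⟩
  · exact (Finset.coe_subset.2 Finset.subset_union_left).trans hs
  · exact (Finset.coe_subset.2 Finset.subset_union_right).trans hs

theorem ultrafilterCovers_of_le {lam : Cardinal.{u}} {D : Ultrafilter (SmallSubsets lam)}
    (h : (D : Filter _) ≤ coveringFilter lam) : UltrafilterCovers D := fun a => by
  have := h ((hasBasis_coveringFilter lam).mem_of_mem (i := {a}) trivial)
  simpa using this

/-! ### Compactness of powers of `ω` -/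

/-- Without a small subcover, each small `s` has a point `x s` outside all sets indexed by `s`. A
limit of `x` along a covering `D` then lies in no member of the cover. -/
theorem NotImpliesOmega.isIntervalCompact {lam kap : Cardinal.{u}} (h : NotImpliesOmega lam kap) :
    IsIntervalCompact lam lam (kap.out → ℕ) := by
  intro C hC hcov hcard
  by_contra! hno
  rw [← mk_out lam] at hcard
  obtain ⟨e⟩ := hcard
  have hx : ∀ s : SmallSubsets lam, ∃ x : kap.out → ℕ, ∀ U : C, e U ∈ s.1 → x ∉ U.1 := by
    intro s
    by_contra! hs
    refine not_lt_of_ge (hno (Subtype.val '' (e ⁻¹' s.1)) (by simp) ?_) ?_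
    · refine Set.eq_univ_of_forall fun x => ?_
      obtain ⟨U, hU, hxU⟩ := hs x
      exact ⟨U.1, ⟨U, hU, rfl⟩, hxU⟩
    · exact (mk_image_le.trans (mk_preimage_of_injective _ _ e.injective)).trans_lt s.2
  choose x hx using hx
  obtain ⟨D, hD, hf⟩ := notImpliesOmega_iff.1 h fun g s => x s g
  choose y hy using hf
  have hlim : Tendsto x D (𝓝 y) := by
    rw [tendsto_pi_nhds]
    intro g
    rw [nhds_discrete, tendsto_pure]
    exact hy g
  obtain ⟨U, hU, hyU⟩ : y ∈ ⋃₀ C := hcov ▸ Set.mem_univ y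
  have hev := hlim ((hC U hU).mem_nhds hyU)
  obtain ⟨s, hs, hs'⟩ := D.nonempty_of_mem (inter_mem hev (hD (e ⟨U, hU⟩)))
  exact hx s ⟨U, hU⟩ hs' hs

/-- A point common to all the closures `K a` is a cluster point of `x` along the covering filter,
hence a limit along a finer ultrafilter. -/
theorem IsIntervalCompact.notImpliesOmega {lam kap : Cardinal.{u}} (hlam : ℵ₀ ≤ lam)
    (h : IsIntervalCompact lam lam (kap.out → ℕ)) : NotImpliesOmega lam kap := by
  rw [notImpliesOmega_iff]
  intro f
  let x : SmallSubsets lam → kap.out → ℕ := fun s g => f g s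
  let K : Finset lam.out → Set (kap.out → ℕ) := fun a =>
    closure (x '' {s | (a : Set lam.out) ⊆ s.1})
  have hinf : Infinite lam.out := by rwa [infinite_iff, mk_out]
  obtain ⟨y, hy⟩ : ∃ y, ∀ a, y ∈ K a := by
    by_contra! hno
    obtain ⟨C', hC', hcov, hcard⟩ := h (Set.range fun a => (K a)ᶜ)
      (by rintro _ ⟨a, rfl⟩; exact isClosed_closure.isOpen_compl)
      (Set.eq_univ_of_forall fun y => by
        obtain ⟨a, ha⟩ := hno y
        exact ⟨_, ⟨a, rfl⟩, ha⟩)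
      (mk_range_le.trans (by rw [mk_finset_of_infinite, mk_out]))
    choose r hr using fun U : C' => hC' U.2
    -- This `s` contains every `r U`, so `x s` lies in all the corresponding closures and escapes
    -- the alleged subcover.
    let s : SmallSubsets lam := ⟨⋃ U, (r U : Set lam.out), mk_iUnion_finset_lt hlam hcard r⟩
    obtain ⟨U, hU, hxU⟩ : x s ∈ ⋃₀ C' := hcov ▸ Set.mem_univ _
    have hmem : x s ∈ (K (r ⟨U, hU⟩))ᶜ := by
      have := hr ⟨U, hU⟩
      simp only at this
      rwa [this]
    exact hmem (subset_closure ⟨s, Set.subset_iUnion (fun U => (r U : Set lam.out)) ⟨U, hU⟩, rfl⟩)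
  have hclus : MapClusterPt y (coveringFilter lam) x :=
    ((hasBasis_coveringFilter lam).map x).clusterPt_iff_forall_mem_closure.2 fun a _ => hy a
  obtain ⟨D, hD, hlim⟩ := mapClusterPt_iff_ultrafilter.1 hclus
  refine ⟨D, ultrafilterCovers_of_le hD, fun g => ⟨y g, ?_⟩⟩
  have := tendsto_pi_nhds.1 hlim g
  rwa [nhds_discrete, tendsto_pure] at this

/-- There are only `lam` basic cylinders. Choosing one member of the cover above each cylinder that
fits into some member leaves at most `lam` sets, which still cover. -/
theorem isFinallyCompact_iff_isIntervalCompact {lam : Cardinal.{u}} (hlam : ℵ₀ ≤ lam) :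
    IsFinallyCompact lam (lam.out → ℕ) ↔ IsIntervalCompact lam lam (lam.out → ℕ) := by
  refine ⟨fun h C hC hcov _ => h C hC hcov, fun h C hC hcov => ?_⟩
  let B : Finset (lam.out × ℕ) → Set (lam.out → ℕ) := fun a => {x | ∀ p ∈ a, x p.1 = p.2}
  let J := {a // ∃ U ∈ C, B a ⊆ U}
  choose V hVC hV using fun a : J => a.2
  have hinf : Infinite lam.out := by rwa [infinite_iff, mk_out]
  have hVcov : ⋃₀ Set.range V = Set.univ := by
    refine Set.eq_univ_of_forall fun x => ?_
    obtain ⟨U, hU, hxU⟩ : x ∈ ⋃₀ C := hcov ▸ Set.mem_univ x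
    obtain ⟨I, t, ht, hsub⟩ := isOpen_pi_iff.1 (hC U hU) x hxU
    classical
    let a : J := ⟨I.image fun i => (i, x i), U, hU, fun z hz => hsub fun i hi => by
      have : z i = x i := hz (i, x i) (Finset.mem_image_of_mem _ hi)
      rw [this]
      exact (ht i hi).2⟩
    refine ⟨V a, ⟨a, rfl⟩, hV a ?_⟩
    intro p hp
    obtain ⟨i, -, rfl⟩ := Finset.mem_image.1 hp
    rfl
  have hVcard : #(Set.range V) ≤ lam := by
    calc #(Set.range V) ≤ #J := mk_range_le
      _ ≤ #(Finset (lam.out × ℕ)) := mk_subtype_le _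
      _ = lam := by
        rw [mk_finset_of_infinite]
        simp [mul_aleph0_eq hlam]
  obtain ⟨C', hC', hcov', hcard⟩ :=
    h (Set.range V) (by rintro _ ⟨a, rfl⟩; exact hC _ (hVC a)) hVcov hVcard
  exact ⟨C', hC'.trans (by rintro _ ⟨a, rfl⟩; exact hVC a), hcov', hcard⟩

/-! ### From compactness of the logic to ultrafilters -/

/-- The propositional vocabulary with a set `P` of propositional variables. -/
def propositionalLanguage (P : Type u) : FirstOrder.Language.{u, u} where
  Functions _ := PEmpty
  Relations n := {_p : P // n = 0}

/-- A propositional variable, as a sentence. -/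
def LomegaSentence.ofProp {P : Type u} (p : P) : LomegaSentence (propositionalLanguage P) :=
  .rel (k := 0) ⟨p, rfl⟩ Fin.elim0

/-- The negation of the conjunction of a finite list of sentences. -/
def LomegaSentence.notAll {L : FirstOrder.Language.{u, v}} :
    List (LomegaSentence L) → LomegaSentence L
  | [] => .falsum
  | φ :: l => .imp φ (notAll l)

theorem LomegaSentence.realize_notAll {L : FirstOrder.Language.{u, v}} {M : Type w} [L.Structure M]
    (l : List (LomegaSentence L)) (x : Fin 0 → M) :
    (notAll l).Realize x ↔ ¬ ∀ φ ∈ l, LomegaFormula.Realize φ x := by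
  induction l with
  | nil => simp [notAll, LomegaFormula.Realize]
  | cons φ l ih => simp [notAll, LomegaFormula.Realize, ih]

/-- The one-point structure given by a valuation of the propositional variables. -/
@[reducible]
def valuationStructure {P : Type u} (w : P → Prop) :
    (propositionalLanguage P).Structure PUnit.{u + 1} where
  funMap f := f.elim
  RelMap R _ := w R.1

/-- The set of propositional variables true in a structure. -/
def trueProps {P : Type u} (M : Type w) [(propositionalLanguage P).Structure M] (p : P) : Prop :=
  FirstOrder.Language.Structure.RelMap (L := propositionalLanguage P) (M := M) (n := 0)
    ⟨p, rfl⟩ Fin.elim0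

theorem LomegaSentence.realize_ofProp {P : Type u} {M : Type w}
    [(propositionalLanguage P).Structure M] (p : P) (x : Fin 0 → M) :
    (ofProp p).Realize x ↔ trueProps M p := by
  simp only [ofProp, LomegaFormula.Realize, trueProps]
  exact iff_of_eq (congrArg _ (Subsingleton.elim _ _))

theorem LomegaSentence.ofProp_injective {P : Type u} :
    Function.Injective (ofProp : P → LomegaSentence (propositionalLanguage P)) := by
  intro p q hpq
  let _ := valuationStructure fun r : P => p = r
  have hp : (ofProp p).Realize (default : Fin 0 → PUnit.{u + 1}) :=
    (realize_ofProp _ _).2 (rfl : p = p)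
  rw [hpq, realize_ofProp] at hp
  exact hp

/-- The side theory forbids finitely many true variables with empty intersection, and makes some
fibre of each `f g` true. `Γ` makes the covering sets true. In a model, the true sets have the
finite intersection property and extend to `D`. -/
theorem LomegaRelCompact.notImpliesOmega {lam kap : Cardinal.{u}} (hlam : ℵ₀ ≤ lam)
    (hkap : lam ≤ kap) (h : LomegaRelCompact kap lam lam) : NotImpliesOmega lam kap := by
  rw [notImpliesOmega_iff]
  intro f
  let P := (kap.out × ℕ) ⊕ lam.out
  let E : P → Set (SmallSubsets lam) :=
    Sum.elim (fun q => {s | f q.1 s = q.2}) fun a => {s | a ∈ s.1}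
  let Q := {l : List P // ∀ s, ∃ p ∈ l, s ∉ E p}
  let τ : Q ⊕ kap.out → LomegaSentence (propositionalLanguage P) :=
    Sum.elim (fun l => LomegaSentence.notAll (l.1.map LomegaSentence.ofProp)) fun g =>
      .disj fun n => LomegaSentence.ofProp (.inl (g, n))
  let ρ : lam.out → LomegaSentence (propositionalLanguage P) := fun a => LomegaSentence.ofProp (.inr a)
  have hk : ℵ₀ ≤ kap := hlam.trans hkap
  have hP : #P = kap := by
    simp [P, mul_aleph0_eq hk, add_eq_left hk hkap]
  have hPinf : Infinite P := by rwa [infinite_iff, hP]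
  have hQ : #Q ≤ kap := (mk_subtype_le _).trans (by rw [mk_list_eq_mk, hP])
  obtain ⟨M, hM, -, hsat⟩ := h (propositionalLanguage P) (Set.range τ) (Set.range ρ)
    (mk_range_le.trans (by
      rw [mk_sum, lift_id, lift_id, mk_out]
      exact add_le_of_le hk hQ le_rfl))
    (mk_range_le.trans (mk_out lam).le) (by
      intro Γ' _ hcard
      have hinj : Function.Injective ρ :=
        LomegaSentence.ofProp_injective.comp Sum.inr_injective
      -- Evaluating membership at the single point `s` gives a model: it is the principal
      -- ultrafilter at `s`.
      let s : SmallSubsets lam := ⟨ρ ⁻¹' Γ', (mk_preimage_of_injective _ _ hinj).trans_lt hcard⟩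
      let _ := valuationStructure fun p : P => s ∈ E p
      have htrue : ∀ p : P, trueProps PUnit.{u + 1} p ↔ s ∈ E p := fun p => Iff.rfl
      refine ⟨PUnit, inferInstance, inferInstance, ?_⟩
      rintro φ (⟨q | g, rfl⟩ | hφ)
      · simp only [τ, Sum.elim_inl, LomegaSentence.realize_notAll, List.mem_map,
          forall_exists_index, and_imp, forall_apply_eq_imp_iff₂, LomegaSentence.realize_ofProp,
          htrue]
        obtain ⟨p, hp, hps⟩ := q.2 s
        exact fun hall => hps (hall p hp)
      · exact ⟨f g s, (LomegaSentence.realize_ofProp _ _).2 ((htrue _).2 rfl)⟩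
      · obtain ⟨a, rfl⟩ := ‹Γ' ⊆ Set.range ρ› hφ
        exact (LomegaSentence.realize_ofProp _ _).2 ((htrue (.inr a)).2 hφ))
  have hfip : ∀ T : Finset (Set (SmallSubsets lam)), (T : Set _) ⊆ E '' {p | trueProps M p} →
      (⋂₀ (T : Set (Set (SmallSubsets lam)))).Nonempty := by
    classical
    intro T hT
    obtain ⟨T', hT', rfl⟩ := Finset.subset_set_image_iff.1 hT
    by_contra hemp
    let q : Q := ⟨T'.toList, fun s => by
      by_contra! hs
      refine hemp ⟨s, ?_⟩
      rintro _ hU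
      obtain ⟨p, hp, rfl⟩ := Finset.mem_image.1 hU
      exact hs p (Finset.mem_toList.2 hp)⟩
    have := hsat (τ (.inl q)) (.inl ⟨_, rfl⟩)
    simp only [τ, Sum.elim_inl, LomegaSentence.realize_notAll, List.mem_map,
      forall_exists_index, and_imp, forall_apply_eq_imp_iff₂, LomegaSentence.realize_ofProp] at this
    exact this fun p hp => hT' (Finset.mem_toList.1 hp)
  obtain ⟨D, hD⟩ := Ultrafilter.exists_ultrafilter_of_finite_inter_nonempty _ hfip
  refine ⟨D, fun a => ?_, fun g => ?_⟩
  · exact hD ⟨.inr a, (LomegaSentence.realize_ofProp _ _).1 (hsat (ρ a) (.inr ⟨a, rfl⟩)), rfl⟩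
  · obtain ⟨n, hn⟩ := hsat (τ (.inr g)) (.inl ⟨_, rfl⟩)
    exact ⟨n, hD ⟨.inl (g, n), (LomegaSentence.realize_ofProp _ _).1 hn, rfl⟩⟩

theorem lomegaCompact_iff_lomegaRelCompact {lam : Cardinal.{u}} (hlam : ℵ₀ ≤ lam) :
    LomegaCompact lam lam ↔ LomegaRelCompact lam lam lam := by
  refine ⟨fun h L S Γ hS hΓ hsat => ?_, fun h L Γ hΓ hsat => ?_⟩
  · refine h L (S ∪ Γ) ((mk_union_le _ _).trans (add_le_of_le hlam hS hΓ)) fun Γ' hΓ' hcard => ?_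
    obtain ⟨M, hM, hne, hmod⟩ := hsat (Γ ∩ Γ') Set.inter_subset_left
      ((mk_le_mk_of_subset Set.inter_subset_right).trans_lt hcard)
    refine ⟨M, hM, hne, fun φ hφ => hmod φ ?_⟩
    exact (hΓ' hφ).imp id fun h => ⟨h, hφ⟩
  · have := h L ∅ Γ (by simp) hΓ fun Γ' hΓ' hcard => by simpa using hsat Γ' hΓ' hcard
    simpa using this

/-! ### Subterms and subformulas -/

/-- The set of subterms of a term. -/
def FirstOrder.Language.Term.subterms {L : FirstOrder.Language.{u, v}} {α : Type w} :
    L.Term α → Set (L.Term α)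
  | .var i => {.var i}
  | .func f ts => insert (.func f ts) (⋃ i, (ts i).subterms)

theorem FirstOrder.Language.Term.self_mem_subterms {L : FirstOrder.Language.{u, v}} {α : Type w}
    (t : L.Term α) : t ∈ t.subterms := by
  cases t <;> simp [subterms]

theorem FirstOrder.Language.Term.countable_subterms {L : FirstOrder.Language.{u, v}} {α : Type w}
    (t : L.Term α) : t.subterms.Countable := by
  induction t with
  | var i => exact Set.countable_singleton _
  | func f ts ih => exact (Set.countable_iUnion ih).insert _

namespace LomegaFormula

variable {L : FirstOrder.Language.{u, v}}

/-- The set of subterms of the terms occurring in a formula. -/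
def subterms : {n : ℕ} → LomegaFormula L n → Set (Σ n, L.Term (Fin n))
  | _, .falsum => ∅
  | n, .equal t₁ t₂ => Sigma.mk n '' (t₁.subterms ∪ t₂.subterms)
  | n, .rel _ ts => Sigma.mk n '' ⋃ i, (ts i).subterms
  | _, .imp φ ψ => φ.subterms ∪ ψ.subterms
  | _, .all φ => φ.subterms
  | _, .conj φ => ⋃ i, (φ i).subterms
  | _, .disj φ => ⋃ i, (φ i).subterms

/-- The set of subformulas of a formula. -/
def subformulas : {n : ℕ} → LomegaFormula L n → Set (Σ n, LomegaFormula L n)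
  | n, .falsum => {⟨n, .falsum⟩}
  | n, .equal t₁ t₂ => {⟨n, .equal t₁ t₂⟩}
  | n, .rel R ts => {⟨n, .rel R ts⟩}
  | n, .imp φ ψ => insert ⟨n, .imp φ ψ⟩ (φ.subformulas ∪ ψ.subformulas)
  | n, .all φ => insert ⟨n, .all φ⟩ φ.subformulas
  | n, .conj φ => insert ⟨n, .conj φ⟩ (⋃ i, (φ i).subformulas)
  | n, .disj φ => insert ⟨n, .disj φ⟩ (⋃ i, (φ i).subformulas)

theorem self_mem_subformulas {n : ℕ} (φ : LomegaFormula L n) : ⟨n, φ⟩ ∈ φ.subformulas := by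
  cases φ <;> simp [subformulas]

theorem countable_subterms {n : ℕ} (φ : LomegaFormula L n) : φ.subterms.Countable := by
  induction φ with
  | falsum => exact Set.countable_empty
  | equal t₁ t₂ => exact (t₁.countable_subterms.union t₂.countable_subterms).image _
  | rel R ts => exact (Set.countable_iUnion fun i => (ts i).countable_subterms).image _
  | imp φ ψ ihφ ihψ => exact ihφ.union ihψ
  | all φ ih => exact ih
  | conj φ ih => exact Set.countable_iUnion ih
  | disj φ ih => exact Set.countable_iUnion ih

theorem countable_subformulas {n : ℕ} (φ : LomegaFormula L n) : φ.subformulas.Countable := by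
  induction φ with
  | falsum => exact Set.countable_singleton _
  | equal t₁ t₂ => exact Set.countable_singleton _
  | rel R ts => exact Set.countable_singleton _
  | imp φ ψ ihφ ihψ => exact (ihφ.union ihψ).insert _
  | all φ ih => exact ih.insert _
  | conj φ ih => exact (Set.countable_iUnion ih).insert _
  | disj φ ih => exact (Set.countable_iUnion ih).insert _

/-- The sequence of the members of a countable conjunction or disjunction. -/
def components : {n : ℕ} → LomegaFormula L n → ℕ → LomegaFormula L n
  | _, .conj φ => φ
  | _, .disj φ => φ
  | _, _ => fun _ => .falsum

end LomegaFormula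

/-! ### Łoś's theorem for small substructures of ultraproducts -/

namespace LomegaFormula

open FirstOrder Language

variable {L : FirstOrder.Language.{u, v}} {I : Type u} (M : I → Type u) [∀ i, L.Structure (M i)]

/-- `F` is closed under the terms in `A` and has counterexamples to all the universal
quantifications of formulas in `B`. -/
structure IsSkolemClosed (A : Set (Σ n, L.Term (Fin n))) (B : Set (Σ n, LomegaFormula L n))
    (F : Set (∀ i, M i)) : Prop where
  nonempty : F.Nonempty
  term_mem : ∀ {n : ℕ} {t : L.Term (Fin n)}, ⟨n, t⟩ ∈ A → ∀ x : Fin n → ∀ i, M i,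
    (∀ k, x k ∈ F) → (fun i => t.realize fun k => x k i) ∈ F
  exists_mem : ∀ {n : ℕ} {φ : LomegaFormula L (n + 1)}, ⟨n + 1, φ⟩ ∈ B →
    ∀ x : Fin n → ∀ i, M i, (∀ k, x k ∈ F) → ∃ b ∈ F, ∀ i,
      φ.Realize (Fin.snoc (fun k => x k i) (b i) : Fin (n + 1) → M i) →
        ∀ c : M i, φ.Realize (Fin.snoc (fun k => x k i) c : Fin (n + 1) → M i)

/-- The vocabulary of the Skolem functions for `A` and `B`. -/
def skolemLanguage (A : Set (Σ n, L.Term (Fin n))) (B : Set (Σ n, LomegaFormula L n)) :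
    FirstOrder.Language.{max u v, 0} where
  Functions n := {a : A // a.1.1 = n} ⊕ {b : B // b.1.1 = n + 1}
  Relations _ := Empty

theorem exists_counterexample {n : ℕ} (φ : LomegaFormula L (n + 1)) {N : Type u} [L.Structure N]
    [Nonempty N] (x : Fin n → N) : ∃ b : N, φ.Realize (Fin.snoc x b : Fin (n + 1) → N) →
      ∀ c : N, φ.Realize (Fin.snoc x c : Fin (n + 1) → N) := by
  by_cases h : ∀ c : N, φ.Realize (Fin.snoc x c : Fin (n + 1) → N)
  · exact ⟨Classical.arbitrary N, fun _ => h⟩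
  · obtain ⟨b, hb⟩ := not_forall.1 h
    exact ⟨b, fun h => absurd h hb⟩

open Classical in
/-- The product of structures, with Skolem functions computed in each factor. -/
@[reducible]
noncomputable def skolemStructure [∀ i, Nonempty (M i)] (A : Set (Σ n, L.Term (Fin n)))
    (B : Set (Σ n, LomegaFormula L n)) : (skolemLanguage A B).Structure (∀ i, M i) where
  funMap f x i := Sum.elim (fun a => a.1.1.2.realize fun k => x (Fin.cast a.2 k) i)
    (fun b => (exists_counterexample (b.2 ▸ b.1.1.2) fun k => x k i).choose) f
  RelMap R := R.elim

end LomegaFormula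

/-- `F` is the hull of one point under Skolem functions acting coordinatewise, so it does not depend
on any ultrafilter. -/
theorem LomegaFormula.exists_isSkolemClosed {L : FirstOrder.Language.{u, u}} {I : Type u}
    (M : I → Type u) [∀ i, L.Structure (M i)] [∀ i, Nonempty (M i)]
    {A : Set (Σ n, L.Term (Fin n))} {B : Set (Σ n, LomegaFormula L n)} {kap : Cardinal.{u}}
    (hkap : ℵ₀ ≤ kap) (hA : #A ≤ kap) (hB : #B ≤ kap) :
    ∃ F : Set (∀ i, M i), IsSkolemClosed M A B F ∧ #F ≤ kap := by
  let _ := skolemStructure M A B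
  let p : ∀ i, M i := fun i => Classical.arbitrary _
  let F := FirstOrder.Language.Substructure.closure (skolemLanguage A B) {p}
  refine ⟨F, ⟨⟨p, FirstOrder.Language.Substructure.subset_closure rfl⟩, ?_, ?_⟩, ?_⟩
  · intro n t ht x hx
    exact F.fun_mem (.inl ⟨⟨⟨n, t⟩, ht⟩, rfl⟩ : (skolemLanguage A B).Functions n) x hx
  · intro n φ hφ x hx
    refine ⟨_, F.fun_mem (.inr ⟨⟨⟨n + 1, φ⟩, hφ⟩, rfl⟩ : (skolemLanguage A B).Functions n) x hx,
      fun i => ?_⟩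
    exact (exists_counterexample φ fun k => x k i).choose_spec
  · have h := FirstOrder.Language.Substructure.lift_card_closure_le
      (L := skolemLanguage A B) (s := {p})
    have hfun : #(Σ n, (skolemLanguage A B).Functions n) ≤ #(A ⊕ B) := by
      refine mk_le_of_injective (f := fun q => q.2.map Subtype.val Subtype.val) ?_
      rintro ⟨m, a | a⟩ ⟨n, b | b⟩ hab
      · obtain ⟨a, rfl⟩ := a
        obtain ⟨b, rfl⟩ := b
        obtain rfl : a = b := by simpa using hab
        rfl
      · simp at hab
      · simp at hab
      · obtain ⟨a, ha⟩ := a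
        obtain ⟨b, hb⟩ := b
        obtain rfl : a = b := by simpa using hab
        obtain rfl : m = n := by omega
        rfl
    simp only [lift_id, mk_singleton] at h
    refine h.trans (max_le hkap (add_le_of_le hkap (one_le_aleph0.trans hkap) (hfun.trans ?_)))
    rw [mk_sum, lift_id, lift_id]
    exact add_le_of_le hkap hA hB

namespace LomegaFormula

open FirstOrder Language

variable {L : FirstOrder.Language.{u, v}} {I : Type u} (M : I → Type u) [∀ i, L.Structure (M i)]
  (D : Ultrafilter I) (F : Set (∀ i, M i))

/-- The image of a set of sequences in the ultraproduct. -/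
abbrev SmallUltraproduct : Type u :=
  {q : (D : Filter I).Product M // ∃ a ∈ F, (a : (D : Filter I).Product M) = q}

variable {M D F}

/-- The element of the image of `F` in the ultraproduct represented by a member of `F`. -/
def SmallUltraproduct.mk (a : F) : SmallUltraproduct M D F := ⟨_, a.1, a.2, rfl⟩

open Classical in
/-- The structure induced by the ultraproduct; functions take an arbitrary value when that of the
ultraproduct is not available. -/
@[reducible]
noncomputable def SmallUltraproduct.structure (p : SmallUltraproduct M D F) :
    L.Structure (SmallUltraproduct M D F) where
  funMap f x :=
    if h : ∃ a ∈ F, (a : (D : Filter I).Product M) = Structure.funMap f fun k => (x k).1 then ⟨_, h⟩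
    else p
  RelMap R x := Structure.RelMap R fun k => (x k).1

/-- Values of all subterms stay in `F`, so the default `p` is never used. -/
theorem SmallUltraproduct.realize_term (p : SmallUltraproduct M D F) {n : ℕ} (x : Fin n → F)
    (t : L.Term (Fin n))
    (ht : ∀ s ∈ t.subterms, (fun i => s.realize fun k => (x k).1 i) ∈ F) :
    let _ : L.Structure (SmallUltraproduct M D F) := SmallUltraproduct.structure p
    t.realize (fun k => SmallUltraproduct.mk (D := D) (x k)) =
      SmallUltraproduct.mk ⟨_, ht t t.self_mem_subterms⟩ := by
  intro _
  induction t with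
  | var k => rfl
  | func f ts ih =>
    have hts : ∀ j, ∀ s ∈ (ts j).subterms, (fun i => s.realize fun k => (x k).1 i) ∈ F :=
      fun j s hs => ht s (Set.mem_insert_of_mem _ (Set.mem_iUnion_of_mem j hs))
    have hval : (Structure.funMap f fun j => (SmallUltraproduct.mk (D := D)
          ⟨_, hts j _ (ts j).self_mem_subterms⟩).1) =
        ((fun i => (Term.func f ts).realize fun k => (x k).1 i : ∀ i, M i) :
          (D : Filter I).Product M) :=
      Ultraproduct.funMap_cast f fun j i => (ts j).realize fun k => (x k).1 i
    rw [Term.realize_func]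
    simp only [fun j => ih j (hts j)]
    apply Subtype.ext
    have hex : ∃ a ∈ F, (a : (D : Filter I).Product M) =
        Structure.funMap f fun j => (SmallUltraproduct.mk (D := D)
          ⟨_, hts j _ (ts j).self_mem_subterms⟩).1 :=
      ⟨_, ht _ (Term.self_mem_subterms _), hval.symm⟩
    exact (congrArg Subtype.val (dif_pos hex)).trans hval

theorem SmallUltraproduct.mk_eq_mk {a b : F} :
    SmallUltraproduct.mk (D := D) a = SmallUltraproduct.mk b ↔ ∀ᶠ i in D, a.1 i = b.1 i :=
  Subtype.ext_iff.trans Quotient.eq''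

/-- `D` decides the countable conjunctions and disjunctions among the formulas in `B`, evaluated
at members of `F`. -/
def Decides (D : Ultrafilter I) (F : Set (∀ i, M i)) (B : Set (Σ n, LomegaFormula L n)) : Prop :=
  ∀ q ∈ B, ∀ x : Fin q.1 → F, ∀ σ : Bool,
    (∀ᶠ i in D, ∃ j, ((q.2.components j).Realize (fun k => (x k).1 i) ↔ σ = true)) →
      ∃ j, ∀ᶠ i in D, ((q.2.components j).Realize (fun k => (x k).1 i) ↔ σ = true)

theorem SmallUltraproduct.realize_iff {A : Set (Σ n, L.Term (Fin n))} {B : Set (Σ n, LomegaFormula L n)}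
    (hF : IsSkolemClosed M A B F) (hD : Decides D F B) (p : SmallUltraproduct M D F)
    {n : ℕ} (φ : LomegaFormula L n) (hA : φ.subterms ⊆ A) (hB : φ.subformulas ⊆ B)
    (x : Fin n → F) :
    let _ : L.Structure (SmallUltraproduct M D F) := SmallUltraproduct.structure p
    φ.Realize (fun k => SmallUltraproduct.mk (D := D) (x k)) ↔
      ∀ᶠ i in D, φ.Realize fun k => (x k).1 i := by
  intro _
  induction φ with
  | falsum => simp [Realize, D.neBot.ne]
  | @equal n t₁ t₂ =>
    have hs : ∀ s ∈ t₁.subterms ∪ t₂.subterms, (fun i => s.realize fun k => (x k).1 i) ∈ F :=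
      fun s hs => hF.term_mem (hA ⟨s, hs, rfl⟩) _ fun k => (x k).2
    simp only [Realize]
    rw [realize_term p x t₁ fun s h => hs s (.inl h), realize_term p x t₂ fun s h => hs s (.inr h),
      mk_eq_mk]
  | @rel n m R ts =>
    have hs : ∀ j, ∀ s ∈ (ts j).subterms, (fun i => s.realize fun k => (x k).1 i) ∈ F :=
      fun j s hs => hF.term_mem (hA ⟨s, Set.mem_iUnion_of_mem j hs, rfl⟩) _ fun k => (x k).2
    simp only [Realize, fun j => realize_term p x (ts j) (hs j)]
    exact relMap_quotient_mk' (s := (D : Filter I).productSetoid M) R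
      fun j i => (ts j).realize fun k => (x k).1 i
  | imp φ ψ ihφ ihψ =>
    simp only [Realize, Ultrafilter.eventually_imp]
    rw [ihφ (Set.subset_union_left.trans hA)
        (Set.subset_union_left.trans ((Set.subset_insert _ _).trans hB)),
      ihψ (Set.subset_union_right.trans hA)
        (Set.subset_union_right.trans ((Set.subset_insert _ _).trans hB))]
  | @all n φ ih =>
    have hB' := (Set.subset_insert _ _).trans hB
    have key : ∀ b : F, φ.Realize (Fin.snoc (fun k => mk (D := D) (x k)) (mk b) :
          Fin (n + 1) → SmallUltraproduct M D F) ↔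
        ∀ᶠ i in D, φ.Realize (Fin.snoc (fun k => (x k).1 i) (b.1 i) : Fin (n + 1) → M i) := by
      intro b
      convert ih hA hB' (Fin.snoc x b) using 2
      · ext k
        refine Fin.lastCases ?_ (fun k => ?_) k <;> simp
      · ext i
        refine iff_of_eq (congrArg _ ?_)
        ext k
        refine Fin.lastCases ?_ (fun k => ?_) k <;> simp
    simp only [Realize]
    constructor
    · intro h
      -- Wherever `φ` holds at the Skolem witness `b`, it holds everywhere in that factor.
      obtain ⟨b, hb, hbx⟩ := hF.exists_mem (hB' φ.self_mem_subformulas) (fun k => (x k).1)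
        fun k => (x k).2
      exact ((key ⟨b, hb⟩).1 (h _)).mono hbx
    · rintro h ⟨_, b, hb, rfl⟩
      exact (key ⟨b, hb⟩).2 (h.mono fun i hi => hi _)
  | @conj n φ ih =>
    have ih' := fun j => ih j ((Set.subset_iUnion (fun j => (φ j).subterms) j).trans hA)
      ((Set.subset_iUnion (fun j => (φ j).subformulas) j).trans ((Set.subset_insert _ _).trans hB)) x
    -- With `false`, `D` selects a single conjunct failing almost everywhere.
    have hdec := hD ⟨n, .conj φ⟩ (hB (Set.mem_insert _ _)) x false
    simp only [components, Bool.false_eq_true, iff_false] at hdec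
    simp only [Realize, ih']
    refine ⟨fun h => ?_, fun h j => h.mono fun i hi => hi j⟩
    by_contra hne
    rw [← Ultrafilter.eventually_not] at hne
    obtain ⟨j, hj⟩ := hdec (hne.mono fun i hi => not_forall.1 hi)
    exact Ultrafilter.eventually_not.1 hj (h j)
  | @disj n φ ih =>
    have ih' := fun j => ih j ((Set.subset_iUnion (fun j => (φ j).subterms) j).trans hA)
      ((Set.subset_iUnion (fun j => (φ j).subformulas) j).trans ((Set.subset_insert _ _).trans hB)) x
    have hdec := hD ⟨n, .disj φ⟩ (hB (Set.mem_insert _ _)) x true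
    simp only [components, iff_true] at hdec
    simp only [Realize, ih']
    exact ⟨fun ⟨j, hj⟩ => hj.mono fun i hi => ⟨j, hi⟩, hdec⟩

end LomegaFormula

/-! ### From ultrafilters to compactness of the logic -/

theorem mk_iUnion_countable_le {ι α : Type u} {c : Cardinal.{u}} (hc : ℵ₀ ≤ c) (hι : #ι ≤ c)
    {s : ι → Set α} (hs : ∀ i, (s i).Countable) : #(⋃ i, s i) ≤ c :=
  (mk_iUnion_le _).trans (mul_le_of_le hc hι
    (ciSup_le' fun i => ((le_aleph0_iff_set_countable.2 (hs i)).trans hc)))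

open LomegaFormula in
theorem NotImpliesOmega.lomegaRelCompact {lam kap : Cardinal.{u}} (hlam : ℵ₀ ≤ lam)
    (hkap : lam ≤ kap) (h : NotImpliesOmega lam kap) : LomegaRelCompact kap lam lam := by
  intro L S Γ hS hΓ hsat
  have hk : ℵ₀ ≤ kap := hlam.trans hkap
  rw [← mk_out lam] at hΓ
  obtain ⟨e⟩ := id hΓ
  have hmod : ∀ s : SmallSubsets lam, LomegaSatisfiable (S ∪ Subtype.val '' (e ⁻¹' s.1)) :=
    fun s => hsat _ (by simp)
      ((mk_image_le.trans (mk_preimage_of_injective _ _ e.injective)).trans_lt s.2)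
  choose M hM hne hmod using hmod
  have hcard : #↥(S ∪ Γ) ≤ kap := (mk_union_le _ _).trans
    (add_le_of_le hk hS (hΓ.trans ((mk_out lam).le.trans hkap)))
  let A := ⋃ φ : ↥(S ∪ Γ), subterms φ.1
  let B := ⋃ φ : ↥(S ∪ Γ), subformulas φ.1
  have hA : #A ≤ kap := mk_iUnion_countable_le hk hcard fun φ => φ.1.countable_subterms
  have hB : #B ≤ kap := mk_iUnion_countable_le hk hcard fun φ => φ.1.countable_subformulas
  obtain ⟨F, hF, hFcard⟩ := exists_isSkolemClosed M hk hA hB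
  let G := Σ q : B, (Fin q.1.1 → F) × Bool
  have hG : #G ≤ kap := by
    rw [mk_sigma]
    refine (sum_le_mk_mul_iSup _).trans (mul_le_of_le hk hB (ciSup_le' fun q => ?_))
    have hpow : #(Fin q.1.1 → F) = #F ^ q.1.1 := by simp
    have hle : #(Fin q.1.1 → F) ≤ kap :=
      hpow.trans_le ((pow_le_pow_left' hFcard _).trans (power_nat_le hk))
    simpa using mul_le_of_le hk hle ((natCast_le_aleph0 (n := 2)).trans hk)
  obtain ⟨D, hcov, hf⟩ := h.exists_ultrafilter hG fun g s =>
    -- The least index with the prescribed truth value. The default `0` on the empty set is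
    -- harmless, since `Decides` assumes an index exists almost everywhere.
    sInf {j | (g.1.1.2.components j).Realize (fun k => (g.2.1 k).1 s) ↔ g.2.2 = true}
  have hD : Decides D F B := fun q hq x σ hex => by
    obtain ⟨n, hn⟩ := hf ⟨⟨q, hq⟩, x, σ⟩
    refine ⟨n, ?_⟩
    filter_upwards [hex, hn] with s hs hsn
    have := Nat.sInf_mem hs
    rwa [← hsn]
  obtain ⟨a, ha⟩ := hF.nonempty
  let p : SmallUltraproduct M D F := SmallUltraproduct.mk ⟨a, ha⟩
  let _ : L.Structure (SmallUltraproduct M D F) := SmallUltraproduct.structure p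
  refine ⟨SmallUltraproduct M D F, inferInstance, ⟨p⟩, fun φ hφ => ?_⟩
  have hlos := SmallUltraproduct.realize_iff hF hD p φ
    (Set.subset_iUnion (fun φ : ↥(S ∪ Γ) => subterms φ.1) ⟨φ, hφ⟩)
    (Set.subset_iUnion (fun φ : ↥(S ∪ Γ) => subformulas φ.1) ⟨φ, hφ⟩) Fin.elim0
  have hmem : {s | φ.Realize (default : Fin 0 → M s)} ∈ D := by
    rcases hφ with hφ | hφ
    · exact Filter.Eventually.of_forall fun s => hmod s φ (.inl hφ)
    · filter_upwards [hcov (e ⟨φ, hφ⟩)] with s hs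
      exact hmod s φ (.inr ⟨⟨φ, hφ⟩, hs, rfl⟩)
  have := hlos.2 (by
    filter_upwards [hmem] with s hs
    convert hs)
  convert this

theorem theorem1 (lam : Cardinal.{u}) (hlam : ℵ₀ ≤ lam) :
    (IsFinallyCompact lam (lam.out → ℕ) ↔ LomegaCompact lam lam) ∧
      ∀ kap : Cardinal.{u}, lam ≤ kap →
        List.TFAE
          [IsIntervalCompact lam lam (kap.out → ℕ),
            LomegaRelCompact kap lam lam,
            NotImpliesOmega lam kap] := by
  have main : ∀ kap : Cardinal.{u}, lam ≤ kap →
      List.TFAE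
        [IsIntervalCompact lam lam (kap.out → ℕ),
          LomegaRelCompact kap lam lam,
          NotImpliesOmega lam kap] := fun kap hkap => by
    tfae_have 1 → 3 := fun h => h.notImpliesOmega hlam
    tfae_have 3 → 1 := fun h => h.isIntervalCompact
    tfae_have 2 → 3 := fun h => h.notImpliesOmega hlam hkap
    tfae_have 3 → 2 := fun h => h.lomegaRelCompact hlam hkap
    tfae_finish
  refine ⟨?_, main⟩
  rw [isFinallyCompact_iff_isIntervalCompact hlam, lomegaCompact_iff_lomegaRelCompact hlam]
  exact (main lam le_rfl).out 0 1
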